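/- A spherical $3$-manifold is a space $M$ homeomorphic to an orbit space $S^3/\Gamma$, where $\Gamma$ is a finite subgroup of $SO(4)$ acting freely on the unit sphere $S^3\subset\mathbb{R}^4$. For a prime $p$, a Sylow $p$-subgroup of a profinite group $G$ is a closed pro-$p$ subgroup $P$ whose index is prime to $p$, i.e. $p\nmid [G:U]$ for every open subgroup $U$ of $G$ containing $P$. Let $M$ be a spherical $3$-manifold, let $x\in M$, let $G=\widehat{\pi_1(M,x)}$ be the profinite completion of its fundamental group, let $p$ be a prime, and let $P$ be a Sylow $p$-subgroup of $G$. (a) If $p$ is odd, then $P$ is cyclic. (b) If $p=2$, then $P$ is isomorphic to one of the following groups: a cyclic group; a dihedral group $D_{2^k}$ of order $2^{k+1}$ for some $k\ge 1$ (where $D_2\cong C_2\times C_2$); a generalized quaternion group $Q_{2^n}$ of order $2^n$ for some $n\ge 3$. -/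

import Mathlib

/-- The unit `3`-sphere in Euclidean `4`-space. -/
abbrev S3 : Type := Metric.sphere (0 : EuclideanSpace ℝ (Fin 4)) 1

/-- The rotation group `SO(4)`: real orthogonal `4 × 4` matrices of determinant `1`. -/
abbrev SO4 : Type := Matrix.specialOrthogonalGroup (Fin 4) ℝ

/-- An orthogonal matrix preserves the Euclidean norm. -/
theorem SO4.norm_mulVec (A : SO4) (x : EuclideanSpace ℝ (Fin 4)) :
    ‖WithLp.toLp 2 ((A : Matrix (Fin 4) (Fin 4) ℝ).mulVec x.ofLp)‖ = ‖x‖ := by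
  have hA : (A : Matrix (Fin 4) (Fin 4) ℝ).transpose * (A : Matrix (Fin 4) (Fin 4) ℝ) = 1 := by
    have h := (Matrix.mem_orthogonalGroup_iff' (Fin 4) ℝ).1
      (Matrix.mem_specialOrthogonalGroup_iff.1 A.2).1
    simpa [Matrix.star_eq_conjTranspose] using h
  have key : ∀ v : Fin 4 → ℝ, ‖WithLp.toLp 2 v‖ ^ 2 = dotProduct v v := fun v => by
    rw [EuclideanSpace.norm_sq_eq]; simp [dotProduct, sq]
  have h2 : ‖WithLp.toLp 2 ((A : Matrix (Fin 4) (Fin 4) ℝ).mulVec x.ofLp)‖ ^ 2 = ‖x‖ ^ 2 := by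
    have hx : ‖x‖ ^ 2 = dotProduct x.ofLp x.ofLp := key x.ofLp
    rw [key, hx, Matrix.dotProduct_mulVec, Matrix.vecMul_mulVec, hA, Matrix.vecMul_one]
  exact (sq_eq_sq₀ (norm_nonneg _) (norm_nonneg _)).1 h2

/-- `SO(4)` acts on the `3`-sphere by `(A, x) ↦ A x`. -/
instance SO4.mulActionS3 : MulAction SO4 S3 where
  smul A x := ⟨WithLp.toLp 2 ((A : Matrix (Fin 4) (Fin 4) ℝ).mulVec x.1.ofLp), by
    have hx := x.2
    rw [mem_sphere_zero_iff_norm] at hx ⊢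
    rw [SO4.norm_mulVec, hx]⟩
  one_smul x := Subtype.ext (congrArg (WithLp.toLp 2) (Matrix.one_mulVec x.1.ofLp))
  mul_smul A B x := Subtype.ext (congrArg (WithLp.toLp 2)
    (Matrix.mulVec_mulVec x.1.ofLp (A : Matrix (Fin 4) (Fin 4) ℝ) B).symm)

/-- A space is a spherical `3`-manifold if it is homeomorphic to the orbit space `S³ / Γ` of a
finite subgroup `Γ` of `SO(4)` that acts freely on `S³`. -/
def IsSphericalThreeManifold (M : Type*) [TopologicalSpace M] : Prop :=
  ∃ Γ : Subgroup SO4, Finite Γ ∧ (∀ g ∈ Γ, ∀ x : S3, g • x = x → g = 1) ∧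
    Nonempty (M ≃ₜ MulAction.orbitRel.Quotient Γ S3)

/-- The profinite completion of the fundamental group `π₁(M, x)`: the inverse limit of its finite
quotients. -/
noncomputable abbrev ProfinitePi1 (M : Type*) [TopologicalSpace M] (x : M) : ProfiniteGrp :=
  ProfiniteGrp.ProfiniteCompletion.completion (GrpCat.of (FundamentalGroup M x))

/-- `H` (to be used for profinite `H`) is pro-`p`: every open normal subgroup has `p`-power
index. -/
def IsProP (p : ℕ) (H : Type*) [Group H] [TopologicalSpace H] : Prop :=
  ∀ N : Subgroup H, N.Normal → IsOpen (N : Set H) → ∃ k : ℕ, N.index = p ^ k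

/-- A Sylow `p`-subgroup of a profinite group `G`: a closed pro-`p` subgroup `P` whose
(supernatural) index, that is the least common multiple of the indices of the open subgroups
of `G` containing `P`, is prime to `p`. -/
structure IsProfiniteSylow (p : ℕ) {G : Type*} [Group G] [TopologicalSpace G]
    (P : Subgroup G) : Prop where
  isClosed : IsClosed (P : Set G)
  isProP : IsProP p P
  index_prime_to : ∀ U : Subgroup G, IsOpen (U : Set G) → P ≤ U → ¬ p ∣ U.index

/-! Since S³ is simply connected and the finite group Γ acts freely, π₁(M) ≅ Γ. A finite group is
its own profinite completion, so `P` is a finite `p`-group acting linearly on ℝ⁴ with no nontrivial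
element fixing a nonzero vector.

Such freeness makes commutative subgroups cyclic (`IsFreeRep.isCyclic_of_comm`) and leaves room for
only one involution, which must act as -1 (`IsFreeRep.eq_of_involutions`). A maximal commutative
normal subgroup A = ⟨a⟩ of `P` is its own centralizer, so everything depends on how `P` conjugates
a.

For odd p the conjugation is trivial, by counting the at most four complex eigenvalues of a
(`IsFreeRep.commute_of_conj_eq_pow`); hence P = A. For p = 2 an element outside A inverts a and
squares to the involution (`inverts_of_sq_mem_zpowers`), which leaves only cyclic and generalized
quaternion groups. -/

/-! ### Simple connectedness of spheres -/

section SphereSimplyConnected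

open scoped unitInterval

variable {E : Type*} [NormedAddCommGroup E] [InnerProductSpace ℝ E]

/-- Radial projection of a nonzero vector to the unit sphere. -/
noncomputable def radialProjection (v : E) (hv : v ≠ 0) : Metric.sphere (0 : E) 1 :=
  ⟨‖v‖⁻¹ • v, by
    rw [mem_sphere_zero_iff_norm, norm_smul, norm_inv, norm_norm,
      inv_mul_cancel₀ (norm_ne_zero_iff.2 hv)]⟩

theorem radialProjection_coe (x : Metric.sphere (0 : E) 1) (v : E) (hv : v ≠ 0) (h : v = x) :
    radialProjection v hv = x := by
  apply Subtype.ext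
  subst h
  simp [radialProjection]

theorem continuous_radialProjection {X : Type*} [TopologicalSpace X] {f : X → E}
    (hf : Continuous f) (h0 : ∀ x, f x ≠ 0) :
    Continuous fun x => radialProjection (f x) (h0 x) :=
  Continuous.subtype_mk ((hf.norm.inv₀ fun x => norm_ne_zero_iff.2 (h0 x)).smul hf) _

/-- The punctured unit sphere is contractible. -/
theorem contractibleSpace_compl_singleton_sphere (v : Metric.sphere (0 : E) 1) :
    ContractibleSpace ({v}ᶜ : Set (Metric.sphere (0 : E) 1)) := by
  have hv : ‖(v : E)‖ = 1 := by simp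
  have hs : (stereographic hv).source = {v}ᶜ := stereographic_source hv
  have e := (stereographic hv).toHomeomorphSourceTarget
  rw [hs, stereographic_target] at e
  exact (e.trans (Homeomorph.Set.univ _)).contractibleSpace

/-- A loop on the unit sphere which misses a point is null-homotopic. -/
theorem homotopic_refl_of_avoids {x v : Metric.sphere (0 : E) 1} (γ : Path x x)
    (hγ : ∀ t, γ t ≠ v) : γ.Homotopic (Path.refl x) := by
  have := contractibleSpace_compl_singleton_sphere v
  have hx : x ≠ v := by simpa using hγ 0
  let S := ({v}ᶜ : Set (Metric.sphere (0 : E) 1))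
  let δ : Path (⟨x, hx⟩ : S) ⟨x, hx⟩ :=
    { toFun := fun t => ⟨γ t, hγ t⟩
      continuous_toFun := γ.continuous.subtype_mk _
      source' := Subtype.ext γ.source
      target' := Subtype.ext γ.target }
  exact (SimplyConnectedSpace.paths_homotopic δ (Path.refl _)).map
    (⟨Subtype.val, continuous_subtype_val⟩ : C(S, Metric.sphere (0 : E) 1))

/-- Paths on the unit sphere are homotopic to the radial projections of nearby paths. -/
theorem exists_homotopic_radialProjection {x y : Metric.sphere (0 : E) 1} (γ : Path x y)
    (q : C(I, E)) (h0 : q 0 = x) (h1 : q 1 = y) (hq : ∀ t, ‖q t - γ t‖ < 1) :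
    ∃ (hne : ∀ t, q t ≠ 0) (δ : Path x y), γ.Homotopic δ ∧
      ∀ t, δ t = radialProjection (q t) (hne t) := by
  -- The segment from `γ t` to `q t` starts at norm 1 and has length less than 1, so it misses the
  -- origin and can be projected radially.
  have key : ∀ (s : I) (t : I), (γ t : E) + (s : ℝ) • (q t - γ t) ≠ 0 := by
    intro s t h
    have h2 := congrArg norm (eq_neg_of_add_eq_zero_left h)
    rw [norm_neg] at h2
    have h3 : ‖(γ t : E)‖ = 1 := by simp
    rw [h3, norm_smul, Real.norm_of_nonneg s.2.1] at h2
    nlinarith [hq t, s.2.1, s.2.2, norm_nonneg (q t - γ t)]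
  have hne : ∀ t, q t ≠ 0 := fun t => by simpa using key 1 t
  let δ : Path x y :=
    { toFun := fun t => radialProjection (q t) (hne t)
      continuous_toFun := continuous_radialProjection q.continuous hne
      source' := radialProjection_coe _ _ _ h0
      target' := radialProjection_coe _ _ _ h1 }
  refine ⟨hne, δ, ⟨⟨⟨⟨fun z => radialProjection _ (key z.1 z.2), ?_⟩, ?_, ?_⟩, ?_⟩⟩, fun t => rfl⟩
  · exact continuous_radialProjection (f := fun z : I × I =>
      (γ z.2 : E) + (z.1 : ℝ) • (q z.2 - γ z.2)) (by fun_prop) fun z => key z.1 z.2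
  · intro t
    exact radialProjection_coe _ _ (key 0 t) (by simp)
  · intro t
    exact Subtype.ext (congrArg (fun v : E => ‖v‖⁻¹ • v) (by simp))
  · rintro s t (rfl | rfl)
    · exact (radialProjection_coe x _ (key s 0) (by simp [h0])).trans γ.source.symm
    · exact (radialProjection_coe y _ (key s 1) (by simp [h1])).trans γ.target.symm

/-- A continuous path in a normed space is uniformly approximated by smooth paths with the same
endpoints. -/
theorem exists_contDiff_near (f : C(I, E)) : ∃ Q : ℝ → E, ContDiff ℝ 1 Q ∧ Q 0 = f 0 ∧ Q 1 = f 1 ∧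
    ∀ t : I, ‖Q t - f t‖ < 1 := by
  have hlim := bernsteinApproximation_uniform f
  obtain ⟨n, hn, hn0⟩ := ((Metric.tendsto_nhds.1 hlim 1 one_pos).and
    (Filter.eventually_ne_atTop 0)).exists
  -- The Bernstein polynomial of `f`, read on all of ℝ. Its value at 1 is `f 1` only for `n ≠ 0`.
  let Q : ℝ → E := fun s => ∑ k : Fin (n + 1),
    ((n.choose k : ℝ) * s ^ (k : ℕ) * (1 - s) ^ (n - k)) • f (bernstein.z k)
  have hQ : ∀ t : I, Q t = bernsteinApproximation n f t := by
    intro t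
    rw [bernsteinApproximation.apply]
    simp [Q, bernstein_apply]
  refine ⟨Q, ?_, ?_, ?_, ?_⟩
  · exact ContDiff.sum fun k _ => by fun_prop
  · simpa using hQ 0
  · simpa [bernsteinApproximation.apply_one hn0] using hQ 1
  · intro t
    rw [hQ, ← dist_eq_norm]
    exact (ContinuousMap.dist_apply_le_dist t).trans_lt hn

/-- The unit sphere of a Euclidean space of dimension at least three is simply connected. -/
theorem simplyConnectedSpace_sphere [FiniteDimensional ℝ E] (hE : 2 < Module.finrank ℝ E) :
    SimplyConnectedSpace (Metric.sphere (0 : E) 1) := by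
  rw [simply_connected_iff_loops_nullhomotopic]
  refine ⟨isPathConnected_iff_pathConnectedSpace.1 (isPathConnected_sphere ?_ 0 zero_le_one), ?_⟩
  · rw [← Module.finrank_eq_rank]
    exact_mod_cast (by omega : 1 < Module.finrank ℝ E)
  intro x γ
  obtain ⟨Q, hQs, hQ0, hQ1, hQ⟩ := exists_contDiff_near
    (⟨fun t => (γ t : E), by fun_prop⟩ : C(I, E))
  obtain ⟨hne, δ, hδ, hδQ⟩ := exists_homotopic_radialProjection γ
    ⟨fun t : I => Q t, hQs.continuous.comp continuous_subtype_val⟩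
    (by simpa using hQ0) (by simpa using hQ1) hQ
  -- The cone over the curve `Q` is a C¹ image of a plane, so it cannot fill `E`; a vector `w` off
  -- the cone gives a direction that `δ` misses.
  have hF : ContDiff ℝ 1 fun z : ℝ × ℝ => z.1 • Q z.2 :=
    contDiff_fst.smul (hQs.comp contDiff_snd)
  have hdim : Module.finrank ℝ (ℝ × ℝ) < Module.finrank ℝ E := by simpa using hE
  obtain ⟨w, hw⟩ := (hF.dense_compl_range_of_finrank_lt_finrank hdim).nonempty
  have hw0 : w ≠ 0 := fun h => hw ⟨(0, 0), by simp [h]⟩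
  refine hδ.trans (homotopic_refl_of_avoids (v := radialProjection w hw0) δ fun t ht => hw ?_)
  rw [hδQ] at ht
  have h2 : ‖Q t‖⁻¹ • Q t = ‖w‖⁻¹ • w := congrArg Subtype.val ht
  refine ⟨(‖w‖ * ‖Q t‖⁻¹, t), ?_⟩
  change (‖w‖ * ‖Q t‖⁻¹) • Q t = w
  rw [mul_smul, h2, smul_inv_smul₀ (norm_ne_zero_iff.2 hw0)]

end SphereSimplyConnected

/-! ### The fundamental group and its profinite completion -/

/-- The canonical map from a finite group to its profinite completion is an isomorphism. -/
theorem bijective_etaFn_of_finite (G : GrpCat) [Finite G] :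
    Function.Bijective (ProfiniteGrp.ProfiniteCompletion.etaFn G) := by
  refine ⟨(ProfiniteGrp.ProfiniteCompletion.etaFn_injective_iff_residuallyFinite G).2
    inferInstance, ?_⟩
  rw [← Set.range_eq_univ, ← (Set.finite_range _).isClosed.closure_eq]
  exact (ProfiniteGrp.ProfiniteCompletion.denseRange G).closure_eq

/-- A finite group is isomorphic to its profinite completion. -/
noncomputable def profiniteCompletionEquiv (G : GrpCat) [Finite G] :
    ProfiniteGrp.ProfiniteCompletion.completion G ≃* G :=
  (MulEquiv.ofBijective (ProfiniteGrp.ProfiniteCompletion.eta G).hom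
    (bijective_etaFn_of_finite G)).symm

/-- A finite pro-`p` group is a `p`-group. -/
theorem IsProP.isPGroup {p : ℕ} {H : Type*} [Group H] [TopologicalSpace H] [T1Space H] [Finite H]
    (h : IsProP p H) : IsPGroup p H := by
  obtain ⟨k, hk⟩ := h ⊥ inferInstance (isOpen_discrete _)
  exact IsPGroup.of_card (n := k) (by rw [← hk, Subgroup.index_bot])

/-- The `3`-sphere is simply connected. -/
instance simplyConnectedSpace_S3 : SimplyConnectedSpace S3 :=
  simplyConnectedSpace_sphere (by simp)

instance continuousConstSMul_S3 : ContinuousConstSMul SO4 S3 where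
  continuous_const_smul A := by
    refine Continuous.subtype_mk ?_ _
    refine (PiLp.continuous_toLp 2 _).comp ?_
    exact Continuous.matrix_mulVec continuous_const
      ((PiLp.continuous_ofLp 2 _).comp continuous_subtype_val)

/-- The fundamental group of a spherical `3`-manifold is isomorphic to the finite group whose
orbit space it is. -/
theorem exists_fundamentalGroup_equiv {M : Type*} [TopologicalSpace M]
    (hM : IsSphericalThreeManifold M) (x : M) :
    ∃ Γ : Subgroup SO4, Finite Γ ∧ (∀ g ∈ Γ, ∀ x : S3, g • x = x → g = 1) ∧
      Nonempty (FundamentalGroup M x ≃* Γ) := by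
  obtain ⟨Γ, hfin, hfree, ⟨φ⟩⟩ := hM
  refine ⟨Γ, hfin, hfree, ?_⟩
  have hcancel : IsCancelSMul Γ S3 := isCancelSMul_iff_eq_one_of_smul_eq.2 fun g y hy =>
    Subtype.ext (hfree g g.2 y hy)
  have : ContinuousConstSMul Γ S3 := ⟨fun g => continuous_const_smul (g : SO4)⟩
  have hq : IsQuotientCoveringMap (Quotient.mk (MulAction.orbitRel Γ S3)) Γ :=
    isQuotientCoveringMap_quotientMk_of_properlyDiscontinuousSMul
  have hp := hq.homeomorph_comp φ.symm
  obtain ⟨e, he⟩ := hp.surjective x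
  -- The covering identifies π₁ with the opposite group of Γ; inversion removes the opposite.
  exact ⟨(hp.fundamentalGroupEquiv (x := x) ⟨e, he⟩).trans (MulEquiv.inv' Γ).symm⟩

/-- A pro-`p` subgroup of the profinite completion of the fundamental group of a spherical
`3`-manifold is a finite `p`-group embedding in `SO(4)` so that it acts freely on the `3`-sphere. -/
theorem exists_free_embedding {M : Type*} [TopologicalSpace M]
    (hM : IsSphericalThreeManifold M) (x : M) {p : ℕ} (P : Subgroup (ProfinitePi1 M x))
    (hP : IsProP p P) : Finite P ∧ IsPGroup p P ∧
      ∃ f : P →* SO4, ∀ g : P, ∀ y : S3, f g • y = y → g = 1 := by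
  obtain ⟨Γ, hfin, hfree, ⟨φ⟩⟩ := exists_fundamentalGroup_equiv hM x
  have hfin1 : Finite (GrpCat.of (FundamentalGroup M x)) := Finite.of_equiv Γ φ.symm.toEquiv
  let ψ : ProfinitePi1 M x ≃* Γ := (profiniteCompletionEquiv _).trans φ
  have hfin2 : Finite (ProfinitePi1 M x) := Finite.of_equiv Γ ψ.symm.toEquiv
  refine ⟨inferInstance, hP.isPGroup, Γ.subtype.comp (ψ.toMonoidHom.comp P.subtype), ?_⟩
  intro g y hy
  have h1 : ψ (g : ProfinitePi1 M x) = 1 := Subtype.ext (hfree _ (ψ g).2 y hy)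
  exact Subtype.ext ((map_eq_one_iff ψ ψ.injective).1 h1)

/-! ### Finite p-groups and the quaternion criterion -/

section PGroups

/-- A nontrivial normal subgroup of a finite `p`-group contains a nontrivial central element. -/
theorem IsPGroup.exists_central_mem_of_normal {p : ℕ} [Fact p.Prime] {Q : Type*} [Group Q]
    [Finite Q] (hQ : IsPGroup p Q) (N : Subgroup Q) [N.Normal] (hN : N ≠ ⊥) :
    ∃ x ∈ N, x ≠ 1 ∧ ∀ g : Q, g * x = x * g := by
  let : MulAction Q N := MulAction.compHom N (MulAut.conjNormal : Q →* MulAut N)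
  -- The number of conjugation-fixed points in `N` is divisible by `p`, so 1 is not the only one.
  have hdvd : p ∣ Nat.card N := (hQ.to_subgroup N).card_eq_or_dvd.resolve_left fun h =>
    hN (Subgroup.card_eq_one.1 h)
  have hfix : (1 : N) ∈ MulAction.fixedPoints Q N := fun g =>
    map_one (MulAut.conjNormal (H := N) g)
  obtain ⟨x, hx, hx1⟩ := hQ.exists_fixed_point_of_prime_dvd_card_of_fixed_point N hdvd hfix
  refine ⟨x, x.2, fun h => hx1 (Subtype.ext h.symm), fun g => ?_⟩
  have h := congrArg Subtype.val (hx g)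
  change ((MulAut.conjNormal g x : N) : Q) = x at h
  rwa [MulAut.conjNormal_apply, mul_inv_eq_iff_eq_mul] at h

/-- A finite `p`-group has a commutative normal subgroup which contains its own centralizer. -/
theorem IsPGroup.exists_normal_comm_centralizer_le {p : ℕ} [Fact p.Prime] {P : Type*} [Group P]
    [Finite P] (hP : IsPGroup p P) : ∃ A : Subgroup P, A.Normal ∧
      (∀ a ∈ A, ∀ b ∈ A, a * b = b * a) ∧ ∀ x : P, (∀ a ∈ A, a * x = x * a) → x ∈ A := by
  obtain ⟨A, hA⟩ := (Set.toFinite {A : Subgroup P | A.Normal ∧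
    ∀ a ∈ A, ∀ b ∈ A, a * b = b * a}).exists_maximal ⟨⊥, inferInstance, by simp⟩
  obtain ⟨hAn, hAc⟩ := hA.prop
  refine ⟨A, hAn, hAc, ?_⟩
  by_contra! hcon
  obtain ⟨y, hy, hyA⟩ := hcon
  -- If the centralizer exceeded `A`, a central element of P/A inside its image would lift to an `x`
  -- that, with `A`, generates a larger commutative normal subgroup.
  let N := (Subgroup.centralizer (A : Set P)).map (QuotientGroup.mk' A)
  have hNn : N.Normal := Subgroup.Normal.map inferInstance _ (QuotientGroup.mk'_surjective A)
  have hN : N ≠ ⊥ := by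
    intro h
    have h1 : (QuotientGroup.mk' A) y ∈ N :=
      Subgroup.mem_map_of_mem _ (Subgroup.mem_centralizer_iff.2 hy)
    rw [h, Subgroup.mem_bot] at h1
    exact hyA ((QuotientGroup.eq_one_iff y).1 h1)
  obtain ⟨q, ⟨x, hxC, rfl⟩, hx1, hxc⟩ := (hP.to_quotient A).exists_central_mem_of_normal N hN
  have hxC' : ∀ a ∈ A, a * x = x * a := Subgroup.mem_centralizer_iff.1 hxC
  let Z := Subgroup.zpowers ((QuotientGroup.mk' A) x)
  have hZn : Z.Normal := by
    refine ⟨?_⟩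
    rintro _ ⟨k, rfl⟩ g
    have h : g * (QuotientGroup.mk' A) x ^ k = (QuotientGroup.mk' A) x ^ k * g :=
      (Commute.zpow_right (hxc g) k).eq
    exact ⟨k, by simp only [h, mul_inv_cancel_right]⟩
  let B := Z.comap (QuotientGroup.mk' A)
  have hAB : A ≤ B := fun a ha => by
    change (QuotientGroup.mk' A) a ∈ Z
    have h : (QuotientGroup.mk' A) a = 1 := (QuotientGroup.eq_one_iff a).2 ha
    rw [h]
    exact one_mem _
  have hB : ∀ b ∈ B, ∃ a ∈ A, ∃ k : ℤ, b = a * x ^ k := by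
    rintro b ⟨k, hk⟩
    refine ⟨b * (x ^ k)⁻¹, ?_, k, by group⟩
    rw [← QuotientGroup.eq_one_iff]
    change (QuotientGroup.mk' A) (b * (x ^ k)⁻¹) = 1
    rw [map_mul, map_inv, map_zpow, mul_inv_eq_one]
    exact hk.symm
  have hBc : ∀ a ∈ B, ∀ b ∈ B, a * b = b * a := by
    intro b hb c hc
    obtain ⟨a, ha, k, rfl⟩ := hB b hb
    obtain ⟨a', ha', l, rfl⟩ := hB c hc
    have h1 : Commute a a' := hAc a ha a' ha'
    have h2 : Commute a (x ^ l) := Commute.zpow_right (hxC' a ha) l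
    have h3 : Commute (x ^ k) a' := (Commute.zpow_right (hxC' a' ha') k).symm
    have h4 : Commute (x ^ k) (x ^ l) := (Commute.refl x).zpow_zpow k l
    exact ((h1.mul_right h2).mul_left (h3.mul_right h4)).eq
  have hxB : x ∈ B := Subgroup.mem_zpowers _
  exact hx1 ((QuotientGroup.eq_one_iff x).2
    (hA.le_of_ge (y := B) ⟨inferInstance, hBc⟩ hAB hxB))

/-- Elementary arithmetic behind the recognition of generalized quaternion groups. -/
theorem two_pow_dvd_add_one {n : ℕ} {r j : ℤ} (hn : 1 ≤ n) (hr : (2 : ℤ) ^ n ∣ r ^ 2 - 1)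
    (hj : (2 : ℤ) ^ n ∣ j * (r - 1)) (hr1 : ¬ (2 : ℤ) ^ n ∣ r - 1)
    (hi : ∀ i : ℤ, ¬ (2 : ℤ) ^ n ∣ j + i * (r + 1)) : (2 : ℤ) ^ n ∣ r + 1 := by
  -- In the application g⁻¹ag = a^r and g² = a^j with a of order 2^n, and `hi` says that no g a^i
  -- squares to 1.
  have hodd : Odd r := by
    have h2 : (2 : ℤ) ∣ r ^ 2 - 1 := (dvd_pow_self 2 (by omega)).trans hr
    by_contra h
    rw [Int.not_odd_iff_even] at h
    obtain ⟨k, rfl⟩ := h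
    obtain ⟨l, hl⟩ := h2
    have : (k + k) ^ 2 - 1 = 2 * (2 * k ^ 2) - 1 := by ring
    omega
  have hcop : ∀ u : ℤ, Odd u → IsCoprime ((2 : ℤ) ^ n) u := by
    rintro u ⟨k, rfl⟩
    exact IsCoprime.pow_left ⟨-k, 1, by ring⟩
  obtain ⟨s, hs⟩ := hodd
  rcases Int.even_or_odd s with ⟨t, ht⟩ | ⟨t, ht⟩
  · -- `r + 1` is twice an odd number
    exfalso
    rcases Int.even_or_odd j with ⟨j', hj'⟩ | hjo
    · obtain ⟨α, β, hαβ⟩ := hcop (2 * t + 1) ⟨t, rfl⟩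
      -- `β` inverts the odd half of `r + 1` modulo 2^n, so this `i` solves j + i(r + 1) ≡ 0.
      refine hi (-(j' * β)) ⟨2 * (j' * α), ?_⟩
      have : r + 1 = 2 * (2 * t + 1) := by omega
      rw [this, hj']
      linear_combination (-2 * j') * hαβ
    · exact hr1 ((hcop j hjo).dvd_of_dvd_mul_left hj)
  · -- `r - 1` is twice an odd number
    have h1 : r - 1 = 2 * (2 * t + 1) := by omega
    have h2j : (2 : ℤ) ^ n ∣ 2 * j := (hcop _ ⟨t, rfl⟩).dvd_of_dvd_mul_right
      (by rwa [h1, show j * (2 * (2 * t + 1)) = 2 * j * (2 * t + 1) by ring] at hj)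
    have h2r : (2 : ℤ) ^ n ∣ 2 * (r + 1) := (hcop _ ⟨t, rfl⟩).dvd_of_dvd_mul_right
      (by rwa [show r ^ 2 - 1 = 2 * (r + 1) * (2 * t + 1) by linear_combination (r + 1) * h1] at hr)
    by_contra hr2
    obtain ⟨m, rfl⟩ : ∃ m, n = m + 1 := ⟨n - 1, by omega⟩
    obtain ⟨c, hc⟩ := h2j
    obtain ⟨d, hd⟩ := h2r
    have hi0 := hi 0
    have hi1 := hi 1
    rw [pow_succ] at hc hd hi0 hi1 hr2
    have hc' : j = 2 ^ m * c := by linarith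
    have hd' : r + 1 = 2 ^ m * d := by linarith
    -- Both `j` and `r + 1` are multiples of 2^m, and `r + 1` is an odd one. Then i = 0 or i = 1
    -- contradicts `hi`, according to the parity of `c`.
    rcases Int.even_or_odd c with ⟨c', rfl⟩ | ⟨c', rfl⟩
    · exact hi0 ⟨c', by rw [hc']; ring⟩
    rcases Int.even_or_odd d with ⟨d', rfl⟩ | ⟨d', rfl⟩
    · exact hr2 ⟨d', by rw [hd']; ring⟩
    · exact hi1 ⟨c' + d' + 1, by rw [hc', hd']; ring⟩

/-- A group with an inverting element outside a cyclic subgroup of index two, whose square is the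
involution of the subgroup, is a generalized quaternion group. -/
theorem nonempty_mulEquiv_quaternionGroup {G : Type*} [Group G] {N : ℕ} {a g : G}
    (ha : orderOf a = 2 * N) (hg : g ∉ Subgroup.zpowers a) (hinv : g⁻¹ * a * g = a⁻¹)
    (hsq : g * g = a ^ N) (hind : ∀ x ∉ Subgroup.zpowers a, g⁻¹ * x ∈ Subgroup.zpowers a) :
    Nonempty (G ≃* QuaternionGroup N) := by
  let e : ZMod (2 * N) →+ Additive G := ZMod.lift (2 * N)
    ⟨zmultiplesHom (Additive G) (Additive.ofMul a), by
      change Additive.ofMul (a ^ (((2 * N : ℕ) : ℤ))) = 0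
      rw [zpow_natCast, ← ha, pow_orderOf_eq_one]; rfl⟩
  let E : ZMod (2 * N) → G := fun i => (e i).toMul
  have hE : ∀ k : ℤ, E (k : ZMod (2 * N)) = a ^ k := fun k => by
    simp only [E, e, ZMod.lift_coe]; rfl
  have hadd : ∀ i j, E (i + j) = E i * E j := fun i j => by simp only [E, map_add]; rfl
  have hmem : ∀ i, E i ∈ Subgroup.zpowers a := fun i => by
    obtain ⟨k, rfl⟩ := ZMod.intCast_surjective i
    exact ⟨k, (hE k).symm⟩
  have hinj : ∀ i, E i = 1 → i = 0 := fun i hi => by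
    obtain ⟨k, rfl⟩ := ZMod.intCast_surjective i
    rw [hE, ← orderOf_dvd_iff_zpow_eq_one, ha] at hi
    exact (ZMod.intCast_zmod_eq_zero_iff_dvd _ _).2 hi
  have hEN : E (N : ZMod (2 * N)) = g * g := by
    have := hE (N : ℤ)
    rw [hsq]
    simpa using this
  have hconj : ∀ i, E i * g = g * E (-i) := fun i => by
    obtain ⟨k, rfl⟩ := ZMod.intCast_surjective i
    rw [← Int.cast_neg, hE, hE, ← inv_mul_eq_iff_eq_mul, ← mul_assoc]
    have h : g⁻¹ * a ^ k * g = (g⁻¹ * a * g) ^ k := by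
      simpa using (conj_zpow (i := k) (a := g⁻¹) (b := a)).symm
    rw [h, hinv, inv_zpow, zpow_neg]
  let F : QuaternionGroup N → G
    | .a i => E i
    | .xa i => g * E i
  have hF : ∀ x y, F (x * y) = F x * F y := by
    rintro (i | i) (j | j)
    · simp only [QuaternionGroup.a_mul_a, F, hadd]
    · simp only [QuaternionGroup.a_mul_xa, F]
      rw [← mul_assoc, hconj, mul_assoc, ← hadd, sub_eq_neg_add]
    · simp only [QuaternionGroup.xa_mul_a, F, hadd, mul_assoc]
    · simp only [QuaternionGroup.xa_mul_xa, F]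
      rw [mul_assoc, ← mul_assoc (E i), hconj, mul_assoc, ← hadd, ← mul_assoc, ← hEN, ← hadd]
      congr 1
      ring
  let φ : QuaternionGroup N →* G := MonoidHom.mk' F hF
  refine ⟨(MulEquiv.ofBijective φ ⟨?_, ?_⟩).symm⟩
  · rw [injective_iff_map_eq_one]
    rintro (i | i) hi
    · rw [hinj i hi]; rfl
    · refine absurd ?_ hg
      have h : g * E i = 1 := hi
      rw [eq_inv_of_mul_eq_one_left h]
      exact inv_mem (hmem i)
  · intro x
    by_cases hx : x ∈ Subgroup.zpowers a
    · obtain ⟨k, rfl⟩ := hx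
      exact ⟨.a k, hE k⟩
    · obtain ⟨k, hk⟩ := hind x hx
      refine ⟨.xa k, ?_⟩
      change g * E k = x
      rw [hE]
      exact mul_eq_of_eq_inv_mul hk

/-- If `G` has at most one involution, an element whose square lies in a self-centralizing cyclic
`2`-subgroup, and which normalizes but is not contained in it, inverts the subgroup and squares to
its involution. -/
theorem inverts_of_sq_mem_zpowers {G : Type*} [Group G]
    (hu : ∀ x y : G, x * x = 1 → y * y = 1 → x ≠ 1 → y ≠ 1 → x = y) {a g : G} {n : ℕ}
    (ha : orderOf a = 2 ^ n) (hc : ∀ x : G, a * x = x * a → x ∈ Subgroup.zpowers a)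
    (hnorm : g⁻¹ * a * g ∈ Subgroup.zpowers a) (hg : g ∉ Subgroup.zpowers a)
    (hsq : g * g ∈ Subgroup.zpowers a) :
    1 ≤ n ∧ g⁻¹ * a * g = a⁻¹ ∧ g * g = a ^ 2 ^ (n - 1) := by
  have hz : ∀ k : ℤ, a ^ k = 1 ↔ (2 : ℤ) ^ n ∣ k := fun k => by
    rw [← orderOf_dvd_iff_zpow_eq_one, ha]; push_cast; rfl
  have hn : 1 ≤ n := by
    by_contra h
    have h0 : n = 0 := by omega
    rw [h0, pow_zero, orderOf_eq_one_iff] at ha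
    exact hg (hc g (by simp [ha]))
  have hhalf : (2 : ℕ) ^ (n - 1) * 2 = 2 ^ n := by rw [← pow_succ]; congr 1; omega
  have hw1 : a ^ 2 ^ (n - 1) ≠ 1 := by
    rw [Ne, ← orderOf_dvd_iff_pow_eq_one, ha]
    intro h
    have := Nat.le_of_dvd (by positivity) h
    have : 0 < 2 ^ (n - 1) := by positivity
    omega
  have hw2 : a ^ 2 ^ (n - 1) * a ^ 2 ^ (n - 1) = 1 := by
    rw [← pow_two, ← pow_mul, hhalf, ← ha, pow_orderOf_eq_one]
  -- The only involution of the group already lies in ⟨a⟩.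
  have hout : ∀ x ∉ Subgroup.zpowers a, x * x ≠ 1 := fun x hx h => hx (by
    rw [hu x _ h hw2 (fun h1 => hx (h1 ▸ one_mem _)) hw1]
    exact Subgroup.npow_mem_zpowers _ _)
  obtain ⟨r, hr⟩ := hnorm
  obtain ⟨j, hj⟩ := hsq
  simp only at hr hj
  have hconj : ∀ k : ℤ, g⁻¹ * a ^ k * g = a ^ (r * k) := fun k => by
    have h : g⁻¹ * a ^ k * g = (g⁻¹ * a * g) ^ k := by
      simpa using (conj_zpow (i := k) (a := g⁻¹) (b := a)).symm
    rw [h, ← hr, zpow_mul]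
  have hr1 : ¬ (2 : ℤ) ^ n ∣ r - 1 := fun h => hg (hc g (by
    rw [← hz, zpow_sub, zpow_one, mul_inv_eq_one, hr] at h
    rwa [mul_assoc, inv_mul_eq_iff_eq_mul] at h))
  have hrr : (2 : ℤ) ^ n ∣ r ^ 2 - 1 := by
    rw [← hz, zpow_sub, zpow_one, mul_inv_eq_one, pow_two, ← hconj, hr]
    have h : (g * g)⁻¹ * a * (g * g) = a := by
      rw [← hj, mul_assoc, inv_mul_eq_iff_eq_mul, ← zpow_one_add, ← zpow_add_one, add_comm]
    calc _ = (g * g)⁻¹ * a * (g * g) := by group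
      _ = a := h
  have hjj : (2 : ℤ) ^ n ∣ j * (r - 1) := by
    rw [← hz, mul_sub, mul_one, zpow_sub, mul_inv_eq_one, mul_comm, ← hconj, hj]
    group
  have hi : ∀ i : ℤ, ¬ (2 : ℤ) ^ n ∣ j + i * (r + 1) := fun i h => by
    refine hout (g * a ^ i) (fun h' => hg ?_) ?_
    · exact (Subgroup.mul_mem_cancel_right _ (Subgroup.zpow_mem_zpowers a i)).1 h'
    · rw [← hz] at h
      rw [← h, zpow_add, hj, mul_add, mul_one, zpow_add, mul_comm i r, ← hconj]
      group
  have hr2 := two_pow_dvd_add_one hn hrr hjj hr1 hi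
  have hg1 : g * g ≠ 1 := hout g hg
  refine ⟨hn, ?_, hu _ _ ?_ hw2 hg1 hw1⟩
  · rw [← hr]
    rw [← hz, zpow_add, zpow_one] at hr2
    exact eq_inv_of_mul_eq_one_left hr2
  · rw [← hj, ← zpow_add, hz]
    obtain ⟨c, hc'⟩ := hjj
    obtain ⟨d, hd⟩ := hr2
    -- 2j = j(r + 1) - j(r - 1), so g² has trivial square.
    exact ⟨j * d - c, by linear_combination j * hd - hc'⟩

/-- A finite `2`-group with at most one involution and a self-centralizing normal cyclic subgroup
is cyclic or generalized quaternion. -/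
theorem IsPGroup.isCyclic_or_quaternion {G : Type*} [Group G] [Finite G] (hG : IsPGroup 2 G)
    (hu : ∀ x y : G, x * x = 1 → y * y = 1 → x ≠ 1 → y ≠ 1 → x = y) (a : G)
    (hn : (Subgroup.zpowers a).Normal) (hc : ∀ x : G, a * x = x * a → x ∈ Subgroup.zpowers a) :
    IsCyclic G ∨ ∃ k : ℕ, 1 ≤ k ∧ Nonempty (G ≃* QuaternionGroup (2 ^ k)) := by
  have : Fact (Nat.Prime 2) := ⟨Nat.prime_two⟩
  obtain ⟨n, ha⟩ := IsPGroup.iff_orderOf.1 hG a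
  have hnorm : ∀ g : G, g⁻¹ * a * g ∈ Subgroup.zpowers a := fun g => by
    simpa using hn.conj_mem a (Subgroup.mem_zpowers a) g⁻¹
  have hsmall : a * a = 1 → ∀ g : G, g * g ∈ Subgroup.zpowers a → g ∈ Subgroup.zpowers a := by
    intro haa g hg
    by_contra hgA
    obtain ⟨-, h, -⟩ := inverts_of_sq_mem_zpowers hu ha hc (hnorm g) hgA hg
    rw [← eq_inv_of_mul_eq_one_left haa, mul_assoc, inv_mul_eq_iff_eq_mul] at h
    exact hgA (hc g h)
  -- Descent: if g⁴ ∈ ⟨a⟩ but g² ∉ ⟨a⟩, then g² inverts a while g raises it to some power s, so s² ≡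
  -- -1 modulo 2^n. This is impossible modulo 4; the case n = 1 falls to `hsmall`.
  have hsq : ∀ (k : ℕ) (g : G), g ^ 2 ^ k ∈ Subgroup.zpowers a → g * g ∈ Subgroup.zpowers a := by
    intro k
    induction k with
    | zero => exact fun g hg => by rw [pow_zero, pow_one] at hg; exact mul_mem hg hg
    | succ k ih =>
      intro g hg
      rw [pow_succ', pow_mul, pow_two] at hg
      have h4 := ih _ hg
      by_contra hgA
      obtain ⟨hn1, hinv, -⟩ := inverts_of_sq_mem_zpowers hu ha hc (hnorm _) hgA h4
      obtain ⟨s, hs⟩ := hnorm g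
      simp only at hs
      have h1 : (g * g)⁻¹ * a * (g * g) = a ^ (s * s) := by
        rw [zpow_mul, hs]
        have h : (g⁻¹ * a * g) ^ s = g⁻¹ * a ^ s * g := by
          simpa using (conj_zpow (i := s) (a := g⁻¹) (b := a))
        rw [h, hs]; group
      have h2 : a ^ (s * s + 1) = 1 := by rw [zpow_add_one, ← h1, hinv, inv_mul_cancel]
      rw [← orderOf_dvd_iff_zpow_eq_one, ha] at h2
      rcases Nat.lt_or_ge 1 n with hn2 | hn2
      · have h4d : (4 : ℤ) ∣ s * s + 1 := by
          refine dvd_trans ?_ h2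
          exact_mod_cast pow_dvd_pow 2 (show 2 ≤ n by omega)
        obtain ⟨c, hc'⟩ := h4d
        rcases Int.even_or_odd s with ⟨t, rfl⟩ | ⟨t, rfl⟩
        · have : (t + t) * (t + t) = 4 * (t * t) := by ring
          omega
        · have : (2 * t + 1) * (2 * t + 1) = 4 * (t * t + t) + 1 := by ring
          omega
      · have hn3 : n = 1 := by omega
        refine hgA (hsmall ?_ _ h4)
        rw [hn3, pow_one] at ha
        rw [← pow_two, ← ha, pow_orderOf_eq_one]
  have hsq' : ∀ g : G, g * g ∈ Subgroup.zpowers a := fun g => by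
    obtain ⟨k, hk⟩ := hG g
    exact hsq k g (by rw [hk]; exact one_mem _)
  by_cases htop : ∀ g : G, g ∈ Subgroup.zpowers a
  · exact Or.inl ⟨a, htop⟩
  right
  push Not at htop
  obtain ⟨g, hg⟩ := htop
  obtain ⟨hn1, hinv, hgg⟩ := inverts_of_sq_mem_zpowers hu ha hc (hnorm g) hg (hsq' g)
  have hn2 : n ≠ 1 := by
    rintro rfl
    refine hg (hsmall ?_ g (hsq' g))
    rw [pow_one] at ha
    rw [← pow_two, ← ha, pow_orderOf_eq_one]
  refine ⟨n - 1, by omega, nonempty_mulEquiv_quaternionGroup ?_ hg hinv hgg fun x hx => hc _ ?_⟩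
  · rw [ha, ← pow_succ']; congr 1; omega
  -- `x` and `g` both invert `a`, so `g⁻¹ * x` centralizes it: ⟨a⟩ has index two.
  · obtain ⟨-, hx', -⟩ := inverts_of_sq_mem_zpowers hu ha hc (hnorm x) hx (hsq' x)
    have h1 : a * x = x * a⁻¹ := by rw [← hx']; group
    have h2 : a * g⁻¹ = g⁻¹ * a⁻¹ := by
      have h3 : g⁻¹ * a⁻¹ * g = a := by
        calc _ = (g⁻¹ * a * g)⁻¹ := by group
          _ = a := by rw [hinv, inv_inv]
      rw [eq_comm, eq_mul_inv_iff_mul_eq]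
      exact h3
    rw [← mul_assoc, h2, mul_assoc, mul_assoc]
    congr 1
    rw [inv_mul_eq_iff_eq_mul, ← mul_assoc, h1, inv_mul_cancel_right]

end PGroups

/-! ### Free linear representations -/

section FreeRepresentations

/-- A matrix representation is free if no nontrivial element fixes a nonzero vector. -/
def IsFreeRep {G K n : Type*} [Group G] [Field K] [Fintype n] [DecidableEq n]
    (ρ : G →* Matrix n n K) : Prop :=
  ∀ (g : G) (v : n → K), v ≠ 0 → (ρ g).mulVec v = v → g = 1

variable {G K n : Type*} [Group G] [Field K] [Fintype n] [DecidableEq n]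

/-- A finite commutative subgroup of a group with a free representation is cyclic. -/
theorem IsFreeRep.isCyclic_of_comm [Nonempty n] {ρ : G →* Matrix n n K} (hρ : IsFreeRep ρ)
    (A : Subgroup G) [Finite A] (hA : ∀ a ∈ A, ∀ b ∈ A, a * b = b * a) : IsCyclic A := by
  let S : Set (Matrix n n K) := (fun a : A => ρ a) '' Set.univ
  have hS : ∀ x ∈ S, ∀ y ∈ S, x * y = y * x := by
    rintro _ ⟨a, -, rfl⟩ _ ⟨b, -, rfl⟩
    simp only [← map_mul, hA a a.2 b b.2]
  let R := Algebra.adjoin K S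
  have hR : IsMulCommutative R := Algebra.isMulCommutative_adjoin K hS
  let : CommRing R := { (inferInstance : Ring R) with mul_comm := hR.is_comm.comm }
  let f : A →* R :=
    { toFun := fun a => ⟨ρ a, Algebra.subset_adjoin ⟨a, trivial, rfl⟩⟩
      map_one' := Subtype.ext (map_one ρ)
      map_mul' := fun a b => Subtype.ext (map_mul ρ (a : G) b) }
  -- `A` is to embed in the units of a residue field of `R`. For a ≠ 1, freeness makes `f a - 1` a
  -- non-zero-divisor, hence a unit in an Artinian ring, so it lies in no maximal ideal.
  have : IsArtinianRing R := IsArtinianRing.of_finite K R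
  obtain ⟨m, hm⟩ := Ideal.exists_maximal R
  let := Ideal.Quotient.field m
  refine isCyclic_of_injective_ringHom ((Ideal.Quotient.mk m : R →* R ⧸ m).comp f) ?_
  rw [injective_iff_map_eq_one]
  intro a ha
  by_contra ha1
  have hmem : f a - 1 ∈ m := by
    rw [← Ideal.Quotient.eq_zero_iff_mem, map_sub, map_one, sub_eq_zero]
    exact ha
  have hunit : IsUnit (f a - 1) := by
    refine IsArtinianRing.isUnit_of_mem_nonZeroDivisors ?_
    rw [mem_nonZeroDivisors_iff_right]
    intro x hx
    rw [mul_comm, sub_mul, one_mul, sub_eq_zero] at hx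
    have hx' : ρ a * (x : Matrix n n K) = x := congrArg Subtype.val hx
    apply Subtype.ext
    ext i j
    by_contra hij
    refine ha1 (Subtype.ext (hρ a ((x : Matrix n n K).col j) (fun h => hij (congrFun h i)) ?_))
    ext k
    exact congrFun (congrFun hx' k) j
  exact hm.ne_top (Ideal.eq_top_of_isUnit_mem _ hmem hunit)

/-- A group with a free representation has at most one involution. -/
theorem IsFreeRep.eq_of_involutions [Nonempty n] {ρ : G →* Matrix n n K} (hρ : IsFreeRep ρ)
    (x y : G) (hx : x * x = 1) (hy : y * y = 1) (hx1 : x ≠ 1) (hy1 : y ≠ 1) : x = y := by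
  have key : ∀ z : G, z * z = 1 → z ≠ 1 → ∀ v, (ρ z).mulVec v = -v := by
    intro z hz hz1 v
    by_contra h
    -- The sum of `v` and its image under an involution is a fixed vector, so it vanishes.
    refine hz1 (hρ z ((ρ z).mulVec v + v) (fun h' => h (eq_neg_of_add_eq_zero_left h')) ?_)
    rw [Matrix.mulVec_add, Matrix.mulVec_mulVec, ← map_mul, hz, map_one, Matrix.one_mulVec,
      add_comm]
  have h := hρ (x * y) (fun _ => 1) (fun h => one_ne_zero (congrFun h (Classical.arbitrary n))) (by
    rw [map_mul, ← Matrix.mulVec_mulVec, key y hy hy1, Matrix.mulVec_neg, key x hx hx1, neg_neg])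
  rw [eq_inv_of_mul_eq_one_left h, eq_comm]
  exact eq_inv_of_mul_eq_one_left hy

/-- The roots of the characteristic polynomial are the eigenvalues. -/
theorem Matrix.isRoot_charpoly_iff_exists_mulVec (A : Matrix n n K) (z : K) :
    A.charpoly.IsRoot z ↔ ∃ v ≠ 0, A.mulVec v = z • v := by
  rw [Polynomial.IsRoot.def, Matrix.eval_charpoly, ← Matrix.exists_mulVec_eq_zero_iff]
  simp only [Matrix.sub_mulVec, sub_eq_zero, Matrix.scalar_apply, ← Matrix.smul_one_eq_diagonal,
    Matrix.smul_mulVec, Matrix.one_mulVec, eq_comm]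

/-- A real matrix fixing a complex vector fixes its real and imaginary parts. This gives access to
eigenvectors over ℂ. -/
theorem IsFreeRep.complexify {ρ : G →* Matrix n n ℝ} (hρ : IsFreeRep ρ) :
    IsFreeRep ((RingHom.mapMatrix Complex.ofRealHom : Matrix n n ℝ →+* _).toMonoidHom.comp ρ) := by
  intro g v hv hg
  by_contra hg1
  have hre : (fun i => (v i).re) = 0 := by
    by_contra h
    refine hg1 (hρ g _ h ?_)
    ext i
    have := congrArg Complex.re (congrFun hg i)
    simpa [Matrix.mulVec, dotProduct] using this
  have him : (fun i => (v i).im) = 0 := by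
    by_contra h
    refine hg1 (hρ g _ h ?_)
    ext i
    have := congrArg Complex.im (congrFun hg i)
    simpa [Matrix.mulVec, dotProduct] using this
  exact hv (funext fun i => Complex.ext (congrFun hre i) (congrFun him i))

/-- If a self-map of prime power order of a finite type has no fixed points, then the prime divides
the cardinality. -/
theorem Function.End.dvd_card_of_forall_ne {α : Type*} [Fintype α] (f : Function.End α) {p k : ℕ}
    (hp : p.Prime) (hf : f^[p ^ k] = id) (hne : ∀ x, f x ≠ x) : p ∣ Fintype.card α := by
  classical
  have : Fact p.Prime := ⟨hp⟩
  have h := Equiv.Perm.card_fixedPoints_modEq (f := f) (p := p) (n := k)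
    ((hom_coe_pow (fun g : Function.End α => g) rfl (fun _ _ => rfl) f (p ^ k)).trans hf)
  have : IsEmpty (Function.fixedPoints f) := ⟨fun x => hne x x.2⟩
  exact Nat.modEq_zero_iff_dvd.1 (h.trans (congrArg (· % p) (Fintype.card_eq_zero_iff.2 this)))

/-- In a finite `p`-group, `p` odd, with a free real representation of dimension four, every
element normalizing a cyclic subgroup centralizes it. -/
theorem IsFreeRep.commute_of_conj_eq_pow {ρ : G →* Matrix (Fin 4) (Fin 4) ℝ} (hρ : IsFreeRep ρ)
    {p : ℕ} (hp : p.Prime) (hp2 : p ≠ 2) (hG : IsPGroup p G) {a g : G} {r : ℕ}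
    (h : g⁻¹ * a * g = a ^ r) : a * g = g * a := by
  by_cases ha1 : a = 1
  · simp [ha1]
  let σ := (RingHom.mapMatrix Complex.ofRealHom :
    Matrix (Fin 4) (Fin 4) ℝ →+* _).toMonoidHom.comp ρ
  have hσ : IsFreeRep σ := hρ.complexify
  let S : Finset ℂ := (σ a).charpoly.roots.toFinset
  have hS : ∀ z, z ∈ S ↔ ∃ v ≠ 0, (σ a).mulVec v = z • v := fun z => by
    rw [Multiset.mem_toFinset, Polynomial.mem_roots (Matrix.charpoly_monic _).ne_zero,
      Matrix.isRoot_charpoly_iff_exists_mulVec]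
  have hpow : ∀ (k : ℕ) (z : ℂ) (v : Fin 4 → ℂ), (σ a).mulVec v = z • v →
      (σ (a ^ k)).mulVec v = z ^ k • v := by
    intro k z v hv
    induction k with
    | zero => simp
    | succ k ih =>
      rw [pow_succ, map_mul, ← Matrix.mulVec_mulVec, hv, Matrix.mulVec_smul, ih, smul_smul,
        pow_succ']
  have hpoweq : ∀ k l : ℕ, a ^ k = a ^ l → ∀ z ∈ S, z ^ k = z ^ l := by
    intro k l hkl z hz
    obtain ⟨v, hv, hvz⟩ := (hS z).1 hz
    have h1 := hpow k z v hvz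
    rw [hkl, hpow l z v hvz] at h1
    exact (smul_left_injective ℂ hv h1).symm
  -- By freeness a single eigenvalue already determines a power of `a`.
  have heqpow : ∀ k l : ℕ, ∀ z ∈ S, z ^ k = z ^ l → a ^ k = a ^ l := by
    intro k l z hz hkl
    obtain ⟨v, hv, hvz⟩ := (hS z).1 hz
    have h1 := hσ ((a ^ l)⁻¹ * a ^ k) v hv (by
      rw [map_mul, ← Matrix.mulVec_mulVec, hpow k z v hvz, hkl, ← hpow l z v hvz,
        Matrix.mulVec_mulVec, ← map_mul, inv_mul_cancel, map_one, Matrix.one_mulVec])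
    exact (inv_mul_eq_one.1 h1).symm
  have hmap : ∀ z ∈ S, z ^ r ∈ S := by
    intro z hz
    obtain ⟨v, hv, hvz⟩ := (hS z).1 hz
    refine (hS _).2 ⟨(σ g).mulVec v, fun h0 => hv ?_, ?_⟩
    · have := congrArg (σ g⁻¹).mulVec h0
      rwa [Matrix.mulVec_mulVec, ← map_mul, inv_mul_cancel, map_one, Matrix.one_mulVec,
        Matrix.mulVec_zero] at this
    · have h1 : a * g = g * a ^ r := by rw [← h]; group
      rw [Matrix.mulVec_mulVec, ← map_mul, h1, map_mul, ← Matrix.mulVec_mulVec, hpow r z v hvz,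
        Matrix.mulVec_smul]
  have hconj : ∀ z ∈ S, star z ∈ S := by
    intro z hz
    obtain ⟨v, hv, hvz⟩ := (hS z).1 hz
    refine (hS _).2 ⟨star v, by simpa using hv, ?_⟩
    ext i
    have := congrArg star (congrFun hvz i)
    simpa [Matrix.mulVec, dotProduct, σ] using this
  obtain ⟨k, hk⟩ := hG a
  obtain ⟨l, hl⟩ := hG g
  have hodd : Odd (p ^ k) := (hp.odd_of_ne_two hp2).pow
  -- the eigenvalues come in pairs of distinct complex conjugates
  have heven : 2 ∣ Fintype.card S := by
    refine Function.End.dvd_card_of_forall_ne (k := 1)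
      (fun z : S => (⟨star z.1, hconj z z.2⟩ : S)) Nat.prime_two ?_ ?_
    · ext z; simp
    -- A real eigenvalue of norm 1 has square 1, which forces a² = 1 and then a = 1, the order being
    -- odd.
    · rintro ⟨z, hz⟩ hzz
      have hzs : star z = z := congrArg Subtype.val hzz
      have hz1 : z ^ p ^ k = 1 := by
        simpa using hpoweq (p ^ k) 0 (by simpa using hk) z hz
      have hnorm : ‖z‖ = 1 := Complex.norm_eq_one_of_pow_eq_one hz1 (pow_ne_zero _ hp.ne_zero)
      have hz2 : z ^ 2 = z ^ 0 := by
        have := Complex.mul_conj' z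
        rw [hnorm, ← Complex.star_def, hzs] at this
        simpa [pow_two] using this
      have ha2 := heqpow 2 0 z hz hz2
      rw [pow_zero] at ha2
      obtain ⟨t, ht⟩ := hodd
      rw [ht, pow_succ, pow_mul, ha2, one_pow, one_mul] at hk
      exact ha1 hk
  have hcard : Fintype.card S ≤ 4 := by
    rw [Fintype.card_coe]
    refine (Multiset.toFinset_card_le _).trans ((Polynomial.card_roots' _).trans ?_)
    rw [Matrix.charpoly_natDegree_eq_dim, Fintype.card_fin]
  have hpos : 0 < Fintype.card S := by
    obtain ⟨z, hz⟩ := IsAlgClosed.exists_root (σ a).charpoly (by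
      rw [Matrix.charpoly_degree_eq_dim]; simp)
    exact Fintype.card_pos_iff.2 ⟨z, (hS z).2
      ((Matrix.isRoot_charpoly_iff_exists_mulVec _ _).1 hz)⟩
  -- raising eigenvalues to the power `r` has a fixed point
  by_cases hfix : ∃ z ∈ S, z ^ r = z
  · obtain ⟨z, hz, hzr⟩ := hfix
    have h1 := heqpow r 1 z hz (by rwa [pow_one])
    rwa [pow_one, ← h, mul_assoc, inv_mul_eq_iff_eq_mul] at h1
  · exfalso
    push Not at hfix
    -- As `g` has `p`-power order, so does the map z ↦ z^r on `S`; without fixed points it makes `p`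
    -- divide the cardinality.
    have hiter : ∀ (m : ℕ), (g ^ m)⁻¹ * a * g ^ m = a ^ r ^ m := by
      intro m
      induction m with
      | zero => simp
      | succ m ih =>
        have h2 : (g⁻¹ * a * g) ^ r ^ m = g⁻¹ * a ^ r ^ m * g := by
          simpa using (conj_pow (i := r ^ m) (a := g⁻¹) (b := a))
        rw [pow_succ' r, pow_mul, ← h, h2, ← ih]
        group
    have hdvd : p ∣ Fintype.card S := by
      refine Function.End.dvd_card_of_forall_ne (k := l)
        (fun z : S => (⟨z.1 ^ r, hmap z z.2⟩ : S)) hp ?_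
        (fun z hz => hfix z z.2 (congrArg Subtype.val hz))
      have hit : ∀ (m : ℕ) (z : S),
          (((fun z : S => (⟨z.1 ^ r, hmap z z.2⟩ : S))^[m] z : S) : ℂ) = z.1 ^ r ^ m := by
        intro m z
        induction m with
        | zero => simp
        | succ m ih => rw [Function.iterate_succ_apply', pow_succ, pow_mul, ← ih]
      ext z
      rw [hit, id]
      have h3 := hiter (p ^ l)
      rw [hl, inv_one, one_mul, mul_one] at h3
      simpa using hpoweq (r ^ p ^ l) 1 (by rw [← h3, pow_one]) z z.2
    have hcop : Nat.Coprime 2 p := (Nat.coprime_primes Nat.prime_two hp).2 (Ne.symm hp2)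
    -- Now 2p divides a positive number that is at most 4.
    have := Nat.le_of_dvd hpos (hcop.mul_dvd_of_dvd_of_dvd heven hdvd)
    have := hp.two_le
    have : p = 2 := by omega
    exact hp2 this

/-- A finite `p`-group with a free four-dimensional real representation is cyclic if `p` is odd,
and cyclic or generalized quaternion if `p = 2`. -/
theorem IsFreeRep.isCyclic_or_quaternion [Finite G] {ρ : G →* Matrix (Fin 4) (Fin 4) ℝ}
    (hρ : IsFreeRep ρ) {p : ℕ} (hp : p.Prime) (hG : IsPGroup p G) :
    IsCyclic G ∨ p = 2 ∧ ∃ k : ℕ, 1 ≤ k ∧ Nonempty (G ≃* QuaternionGroup (2 ^ k)) := by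
  have : Fact p.Prime := ⟨hp⟩
  obtain ⟨A, hAn, hAc, hA⟩ := hG.exists_normal_comm_centralizer_le
  obtain ⟨a, ha⟩ := Subgroup.isCyclic_iff_exists_zpowers_eq_top A |>.1 (hρ.isCyclic_of_comm A hAc)
  have hc : ∀ x : G, a * x = x * a → x ∈ A := fun x hx => hA x fun b hb => by
    rw [← ha] at hb
    obtain ⟨k, rfl⟩ := hb
    exact (Commute.zpow_left hx k).eq
  by_cases hp2 : p = 2
  · subst hp2
    subst ha
    exact (hG.isCyclic_or_quaternion hρ.eq_of_involutions a hAn hc).imp_right fun h => ⟨rfl, h⟩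
  · left
    refine ⟨a, fun g => ?_⟩
    change g ∈ Subgroup.zpowers a
    rw [ha]
    refine hc g ?_
    have hmem : g⁻¹ * a * g ∈ Subgroup.zpowers a := by
      rw [ha]
      simpa using hAn.conj_mem a (ha ▸ Subgroup.mem_zpowers a) g⁻¹
    obtain ⟨r, hr⟩ := (isOfFinOrder_of_finite a).mem_powers_iff_mem_zpowers.2 hmem
    exact hρ.commute_of_conj_eq_pow hp hp2 hG hr.symm

end FreeRepresentations

/-! ### From free actions on the sphere to the theorem -/

/-- A homomorphism to `SO(4)` through which a group acts freely on the `3`-sphere is a free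
representation. -/
theorem isFreeRep_of_free_action {G : Type*} [Group G] (f : G →* SO4)
    (hf : ∀ (g : G) (y : S3), f g • y = y → g = 1) :
    IsFreeRep ((Matrix.specialOrthogonalGroup (Fin 4) ℝ).subtype.comp f) := by
  intro g v hv hg
  have hv' : WithLp.toLp 2 v ≠ 0 := by simpa using hv
  refine hf g (radialProjection (WithLp.toLp 2 v) hv') (Subtype.ext ?_)
  change WithLp.toLp 2 (((f g : SO4) : Matrix (Fin 4) (Fin 4) ℝ).mulVec
    (‖WithLp.toLp 2 v‖⁻¹ • v)) = ‖WithLp.toLp 2 v‖⁻¹ • WithLp.toLp 2 v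
  rw [Matrix.mulVec_smul]
  exact congrArg (fun w => WithLp.toLp 2 (‖WithLp.toLp 2 v‖⁻¹ • w)) hg

theorem mainTheorem10 {M : Type*} [TopologicalSpace M] (hM : IsSphericalThreeManifold M) (x : M)
    (p : ℕ) (hp : p.Prime) (P : Subgroup (ProfinitePi1 M x)) (hP : IsProfiniteSylow p P) :
    (p ≠ 2 → IsCyclic P) ∧
    (p = 2 →
      IsCyclic P ∨
      (∃ k : ℕ, 1 ≤ k ∧ Nonempty (P ≃* DihedralGroup (2 ^ k))) ∨
      (∃ n : ℕ, 3 ≤ n ∧ Nonempty (P ≃* QuaternionGroup (2 ^ (n - 2))))) := by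
  obtain ⟨hfin, hPp, f, hf⟩ := exists_free_embedding hM x P hP.isProP
  rcases (isFreeRep_of_free_action f hf).isCyclic_or_quaternion hp hPp with h | ⟨h2, k, hk, h⟩
  · exact ⟨fun _ => h, fun _ => Or.inl h⟩
  -- `QuaternionGroup (2 ^ k)` has order 2^(k+2), whence n = k + 2. The dihedral alternative is
  -- never needed.
  · exact ⟨fun h' => absurd h2 h', fun _ => Or.inr (Or.inr ⟨k + 2, by omega, h⟩)⟩
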